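/- Let $\mathbb{D}$ be the open unit disk and $\mathbb{T}$ the unit circle. For $1<q<\infty$ let $H^q$ be the space of holomorphic functions $g$ on $\mathbb{D}$ with $$\|g\|_q^q:=\sup_{0<r<1}\frac1{2\pi}\int_0^{2\pi}|g(re^{i\theta})|^q\,d\theta<\infty .$$ An inner function is a bounded holomorphic function on $\mathbb{D}$ whose non-tangential boundary values have modulus one almost everywhere on $\mathbb{T}$. On $\mathbb{T}$, functions in $H^q$ and inner functions are identified with their non-tangential boundary values, which exist almost everywhere. Let $J_1$ and $J_2$ be non-constant inner functions with $J_1(0)\neq0$ and $J_2(0)\neq0$. Then, for every $1<q<\infty$, both of the following suprema are finite and $$\sup_{g\in H^q,\ \|g\|_q\le1}\left|\frac1{2\pi i}\int_{\mathbb{T}} g\,\overline{J_1}\,d\zeta\right|<\sup_{g\in H^q,\ \|g\|_q\le1}\left|\frac1{2\pi i}\int_{\mathbb{T}} g\,\overline{J_1J_2}\,d\zeta\right| .$$ -/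

import Mathlib

open Set Filter Topology MeasureTheory

noncomputable section

namespace HardyDual

/-- The Stolz (non-tangential approach) region in the open unit disk with vertex `ζ` on the unit
circle and aperture `M > 1`. -/
def stolz (ζ : ℂ) (M : ℝ) : Set ℂ :=
  {z | ‖z‖ < 1 ∧ ‖z - ζ‖ < M * (1 - ‖z‖)}

/-- `f` has the non-tangential limit `c` at the point `ζ` of the unit circle. -/
def HasNontangentialLimit (f : ℂ → ℂ) (ζ c : ℂ) : Prop :=
  ∀ M : ℝ, 1 < M → Tendsto f (𝓝[stolz ζ M] ζ) (𝓝 c)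

/-- `F` is the boundary function of `f` on the unit circle: at almost every point of the circle,
`F` is the non-tangential limit of `f`. This determines `F` on the circle up to a null set. -/
def IsBoundaryFunction (f F : ℂ → ℂ) : Prop :=
  ∀ᵐ θ : ℝ, HasNontangentialLimit f (circleMap 0 1 θ) (F (circleMap 0 1 θ))

/-- The set of the integral means `(1/2π) ∫₀^{2π} |f(r e^{iθ})|^q dθ`, `0 < r < 1`. -/
def integralMeans (q : ℝ) (f : ℂ → ℂ) : Set ℝ :=
  (fun r : ℝ => Real.circleAverage (fun z => ‖f z‖ ^ q) 0 r) '' Ioo 0 1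

/-- `f` belongs to the Hardy space `H^q` of the unit disk (`0 < q < ∞`). Only the values of `f`
in the open unit disk matter. -/
def MemHardy (q : ℝ) (f : ℂ → ℂ) : Prop :=
  DifferentiableOn ℂ f (Metric.ball 0 1) ∧ BddAbove (integralMeans q f)

/-- The norm of `H^q`. -/
def hardyNorm (q : ℝ) (f : ℂ → ℂ) : ℝ :=
  sSup (integralMeans q f) ^ (1 / q)

/-- `J` is an inner function: a bounded holomorphic function on the unit disk whose boundary
values have modulus one almost everywhere. -/
def IsInner (J : ℂ → ℂ) : Prop :=
  DifferentiableOn ℂ J (Metric.ball 0 1) ∧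
    (∃ C : ℝ, ∀ z ∈ Metric.ball (0 : ℂ) 1, ‖J z‖ ≤ C) ∧
    ∃ F : ℂ → ℂ, IsBoundaryFunction J F ∧ ∀ᵐ θ : ℝ, ‖F (circleMap 0 1 θ)‖ = 1

/-- `J` is constant on the open unit disk. -/
def IsConstantOnDisk (J : ℂ → ℂ) : Prop :=
  ∃ c : ℂ, ∀ z ∈ Metric.ball (0 : ℂ) 1, J z = c

/-- The set of all `|(1/2πi) ∫_𝕋 g conj(J) dζ|` where `g` runs over the closed unit ball of `H^q`;
on the circle, `g` and `J` stand for their boundary functions `G` and `F`. -/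
def dualValues (q : ℝ) (J : ℂ → ℂ) : Set ℝ :=
  {x | ∃ g G F : ℂ → ℂ, MemHardy q g ∧ hardyNorm q g ≤ 1 ∧
    IsBoundaryFunction g G ∧ IsBoundaryFunction J F ∧
    x = ‖(2 * (Real.pi : ℂ) * Complex.I)⁻¹ *
      ∮ ζ in C(0, 1), G ζ * (starRingEnd ℂ) (F ζ)‖}

end HardyDual

end

/-!
Let `J` be inner with `a = J(0)`, `|a| < 1`. For `φ` analytic near the closed disk,
`conj J * φ(J) - φ(0) * conj J` is on the circle the boundary function of a bounded analytic
function, so `conj J` may be replaced by `conj J * φ(J) / φ(0)` without changing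
`(1/2πi) ∫ g conj(J) dζ`. Let `1/p + 1/q = 1` and `φ(w) = (1 - conj a * w) ^ (2/p)`. As
`∫ |1 - conj a * J|² = 1 - |a|²`, Hölder's inequality bounds the supremum by
`(1 - |a|²) ^ (1 - 1/q)`, and equality holds for a multiple of
`(J - a) / z * (1 - conj a * J) ^ (2/q - 1)`. This value decreases with `|a|`, and multiplying `J₁`
by `J₂` strictly decreases `|J₁(0)| ≠ 0`.
-/

namespace HardyDual

open scoped ComplexConjugate ENNReal

section UniformIntegrability

variable {α ι E : Type*} [MeasurableSpace α] {μ : Measure α} [NormedAddCommGroup E]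

theorem unifIntegrable_of_eLpNorm_le {p q : ℝ≥0∞} (hp : p ≠ 0) (hpq : p < q)
    {f : ι → α → E} (hf : ∀ i, AEStronglyMeasurable (f i) μ) {C : ℝ≥0∞} (hC : C ≠ ∞)
    (hfC : ∀ i, eLpNorm (f i) q μ ≤ C) : UnifIntegrable f p μ := by
  intro ε hε
  set s : ℝ := 1 / p.toReal - 1 / q.toReal
  have hs : 0 < s := by
    have hp0 : 0 < p.toReal := ENNReal.toReal_pos hp hpq.ne_top
    rcases eq_or_ne q ∞ with rfl | hq
    · simpa [s] using hp0
    · exact sub_pos.2 (one_div_lt_one_div_of_lt hp0 (ENNReal.toReal_strict_mono hq hpq))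
  have hlim : Tendsto (fun δ => C * ENNReal.ofReal δ ^ s) (𝓝[>] 0) (𝓝 0) := by
    refine (ENNReal.tendsto_const_mul_rpow_nhds_zero_of_pos hC hs).comp ?_
    simpa using (ENNReal.continuous_ofReal.tendsto 0).mono_left nhdsWithin_le_nhds
  obtain ⟨δ, hδε, hδ⟩ := ((hlim.eventually (ge_mem_nhds (ENNReal.ofReal_pos.2 hε))).and
    self_mem_nhdsWithin).exists
  refine ⟨δ, hδ, fun i A hA hμA => ?_⟩
  calc eLpNorm (A.indicator (f i)) p μ
      = eLpNorm (f i) p (μ.restrict A) := eLpNorm_indicator_eq_eLpNorm_restrict hA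
    _ ≤ eLpNorm (f i) q (μ.restrict A) * (μ.restrict A) univ ^ s :=
        eLpNorm_le_eLpNorm_mul_rpow_measure_univ hpq.le (hf i).restrict
    _ ≤ C * ENNReal.ofReal δ ^ s := by
        rw [Measure.restrict_apply_univ]
        gcongr
        exact (eLpNorm_mono_measure _ Measure.restrict_le_self).trans (hfC i)
    _ ≤ ENNReal.ofReal ε := hδε

theorem tendsto_integral_of_tendsto_ae_of_eLpNorm_le [NormedSpace ℝ E] [IsFiniteMeasure μ]
    {p : ℝ≥0∞} (hp : 1 < p) {f : ℕ → α → E} {g : α → E}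
    (hf : ∀ n, AEStronglyMeasurable (f n) μ) {C : ℝ≥0∞} (hC : C ≠ ∞)
    (hfC : ∀ n, eLpNorm (f n) p μ ≤ C)
    (hlim : ∀ᵐ x ∂μ, Tendsto (fun n => f n x) atTop (𝓝 (g x))) :
    Tendsto (fun n => ∫ x, f n x ∂μ) atTop (𝓝 (∫ x, g x ∂μ)) := by
  have hfp n : MemLp (f n) p μ := ⟨hf n, (hfC n).trans_lt hC.lt_top⟩
  have hgp : MemLp g p μ := ⟨aestronglyMeasurable_of_tendsto_ae atTop hf hlim,
    (Lp.eLpNorm_le_of_ae_tendsto (Eventually.of_forall hfC) hf hlim).trans_lt hC.lt_top⟩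
  exact tendsto_integral_of_L1' _ hgp.1
    (Eventually.of_forall fun n => (hfp n).integrable hp.le)
    (tendsto_Lp_finite_of_tendsto_ae le_rfl ENNReal.one_ne_top hf (hgp.mono_exponent hp.le)
      (unifIntegrable_of_eLpNorm_le one_ne_zero hp hf hC hfC) hlim)

end UniformIntegrability

theorem one_sub_norm_sq_pos {a : ℂ} (ha : ‖a‖ < 1) : 0 < 1 - ‖a‖ ^ 2 :=
  sub_pos.2 (pow_lt_one₀ (norm_nonneg a) ha two_ne_zero)

theorem norm_one_sub_conj_mul_sq (a w : ℂ) :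
    ‖1 - conj a * w‖ ^ 2 = 1 - 2 * (conj a * w).re + ‖a‖ ^ 2 * ‖w‖ ^ 2 := by
  simp only [← Complex.normSq_eq_norm_sq, Complex.normSq_apply, Complex.sub_re, Complex.sub_im,
    Complex.mul_re, Complex.mul_im, Complex.conj_re, Complex.conj_im, Complex.one_re,
    Complex.one_im]
  ring

theorem norm_sub_le_norm_one_sub_conj_mul {a w : ℂ} (ha : ‖a‖ ≤ 1) (hw : ‖w‖ ≤ 1) :
    ‖w - a‖ ≤ ‖1 - conj a * w‖ := by
  refine le_of_pow_le_pow_left₀ two_ne_zero (norm_nonneg _) ?_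
  have hsub : ‖w - a‖ ^ 2 = ‖w‖ ^ 2 - 2 * (conj a * w).re + ‖a‖ ^ 2 := by
    simp only [← Complex.normSq_eq_norm_sq, Complex.normSq_apply, Complex.sub_re, Complex.sub_im,
      Complex.mul_re, Complex.conj_re, Complex.conj_im]
    ring
  rw [hsub, norm_one_sub_conj_mul_sq]
  have ha2 : ‖a‖ ^ 2 ≤ 1 := pow_le_one₀ (norm_nonneg _) ha
  have hw2 : ‖w‖ ^ 2 ≤ 1 := pow_le_one₀ (norm_nonneg _) hw
  nlinarith

theorem one_sub_conj_mul_mem_slitPlane {a w : ℂ} (ha : ‖a‖ < 1) (hw : ‖w‖ ≤ 1) :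
    1 - conj a * w ∈ Complex.slitPlane := by
  rw [sub_eq_add_neg]
  refine Complex.mem_slitPlane_of_norm_lt_one ?_
  rw [norm_neg, norm_mul, RCLike.norm_conj]
  exact mul_lt_one_of_nonneg_of_lt_one_left (norm_nonneg _) ha hw

theorem integral_norm_one_sub_conj_mul_sq_le {α : Type*} [MeasurableSpace α] {μ : Measure α}
    [IsProbabilityMeasure μ] {f : α → ℂ} (hf : AEStronglyMeasurable f μ)
    (hf1 : ∀ᵐ x ∂μ, ‖f x‖ ≤ 1) :
    ∫ x, ‖1 - conj (∫ y, f y ∂μ) * f x‖ ^ 2 ∂μ ≤ 1 - ‖∫ y, f y ∂μ‖ ^ 2 := by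
  set a := ∫ y, f y ∂μ with ha
  have hfi : Integrable f μ := Integrable.of_bound hf 1 hf1
  have hre : Integrable (fun x => (conj a * f x).re) μ := (hfi.const_mul _).re
  have hre_eq : ∫ x, (conj a * f x).re ∂μ = ‖a‖ ^ 2 := by
    calc ∫ x, (conj a * f x).re ∂μ = (∫ x, conj a * f x ∂μ).re := integral_re (hfi.const_mul _)
      _ = ‖a‖ ^ 2 := by rw [integral_const_mul, ← ha, Complex.conj_mul']; norm_cast
  calc ∫ x, ‖1 - conj a * f x‖ ^ 2 ∂μ
      ≤ ∫ x, ((1 + ‖a‖ ^ 2) - 2 * (conj a * f x).re) ∂μ := by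
        refine integral_mono_of_nonneg (Eventually.of_forall fun x => by positivity)
          ((integrable_const _).sub (hre.const_mul 2)) ?_
        filter_upwards [hf1] with x hx
        have : ‖f x‖ ^ 2 ≤ 1 := pow_le_one₀ (norm_nonneg _) hx
        rw [norm_one_sub_conj_mul_sq]
        nlinarith [sq_nonneg ‖a‖]
    _ = 1 - ‖a‖ ^ 2 := by
        rw [integral_sub (integrable_const _) (hre.const_mul 2), integral_const_mul, hre_eq,
          integral_const, probReal_univ, one_smul]
        ring

theorem schwarz_pick_zero {f : ℂ → ℂ}
    (hf : DifferentiableOn ℂ f (Metric.ball 0 1))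
    (hf1 : MapsTo f (Metric.ball 0 1) (Metric.closedBall 0 1)) (ha : ‖f 0‖ < 1) {z : ℂ}
    (hz : z ∈ Metric.ball (0 : ℂ) 1) :
    ‖f z - f 0‖ ≤ ‖z‖ * ‖1 - conj (f 0) * f z‖ := by
  have hf1' : ∀ w ∈ Metric.ball (0 : ℂ) 1, ‖f w‖ ≤ 1 := fun w hw =>
    mem_closedBall_zero_iff.1 (hf1 hw)
  have hne : ∀ w ∈ Metric.ball (0 : ℂ) 1, 1 - conj (f 0) * f w ≠ 0 := fun w hw =>
    Complex.slitPlane_ne_zero (one_sub_conj_mul_mem_slitPlane ha (hf1' w hw))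
  set ψ : ℂ → ℂ := fun w => (f w - f 0) / (1 - conj (f 0) * f w)
  have hψ : DifferentiableOn ℂ ψ (Metric.ball 0 1) :=
    (hf.sub_const _).div ((hf.const_mul _).const_sub 1) hne
  have hψ0 : ψ 0 = 0 := by simp [ψ]
  have hψ1 : MapsTo ψ (Metric.ball 0 1) (Metric.closedBall 0 1) := fun w hw => by
    rw [mem_closedBall_zero_iff, norm_div]
    exact div_le_one_of_le₀ (norm_sub_le_norm_one_sub_conj_mul ha.le (hf1' w hw)) (norm_nonneg _)
  have hschwarz : ‖ψ z‖ ≤ ‖z‖ :=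
    Complex.norm_le_norm_of_mapsTo_ball hψ hψ1 hψ0 (mem_ball_zero_iff.1 hz)
  rwa [norm_div, div_le_iff₀ (norm_pos_iff.2 (hne z hz))] at hschwarz

theorem analyticOnNhd_dslope {φ : ℂ → ℂ} {c : ℂ} {s : Set ℂ} (hc : c ∈ s)
    (hφ : AnalyticOnNhd ℂ φ s) : AnalyticOnNhd ℂ (dslope φ c) s := by
  have hU : IsOpen {w | AnalyticAt ℂ φ w} := isOpen_analyticAt ℂ φ
  have hd : DifferentiableOn ℂ (dslope φ c) {w | AnalyticAt ℂ φ w} :=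
    (Complex.differentiableOn_dslope (hU.mem_nhds (hφ c hc))).2
      fun w hw => hw.differentiableAt.differentiableWithinAt
  exact (hd.analyticOnNhd hU).mono hφ

theorem eq_add_mul_dslope_zero (φ : ℂ → ℂ) (w : ℂ) : φ w = φ 0 + w * dslope φ 0 w := by
  have h := sub_smul_dslope φ 0 w
  rw [sub_zero, smul_eq_mul] at h
  rw [h, add_sub_cancel]

theorem conj_mul_eq_of_norm_eq_one (φ : ℂ → ℂ) {w : ℂ} (hw : ‖w‖ = 1) :
    conj w * φ w = φ 0 * conj w + dslope φ 0 w := by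
  have hw1 : conj w * w = 1 := by rw [Complex.conj_mul', hw]; simp
  linear_combination conj w * eq_add_mul_dslope_zero φ w + dslope φ 0 w * hw1

/-- The principal branch of `(1 - conj a * w) ^ s` as a function of `w`, for `‖a‖ < 1` a zero-free
analytic function near the closed disk: a power of the reciprocal of the Szegő kernel at `a`. -/
noncomputable def kernelPow (a : ℂ) (s : ℝ) (w : ℂ) : ℂ := (1 - conj a * w) ^ (s : ℂ)

theorem kernelPow_zero (a : ℂ) (s : ℝ) : kernelPow a s 0 = 1 := by simp [kernelPow]

theorem norm_kernelPow (a : ℂ) (s : ℝ) (w : ℂ) : ‖kernelPow a s w‖ = ‖1 - conj a * w‖ ^ s :=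
  Complex.norm_cpow_real _ _

theorem analyticOnNhd_kernelPow {a : ℂ} (ha : ‖a‖ < 1) (s : ℝ) :
    AnalyticOnNhd ℂ (kernelPow a s) (Metric.closedBall 0 1) := fun _ hw =>
  (analyticAt_const.sub (analyticAt_const.mul analyticAt_id)).cpow analyticAt_const
    (one_sub_conj_mul_mem_slitPlane ha (mem_closedBall_zero_iff.1 hw))

/-- The normalized arc length measure of the unit circle, in the angular coordinate. -/
noncomputable def circleMeasure : Measure ℝ :=
  ENNReal.ofReal (2 * Real.pi)⁻¹ • volume.restrict (Ioc 0 (2 * Real.pi))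

instance : IsProbabilityMeasure circleMeasure := by
  constructor
  simp only [circleMeasure, Measure.smul_apply, Measure.restrict_apply_univ, Real.volume_Ioc,
    sub_zero, smul_eq_mul]
  rw [← ENNReal.ofReal_mul (by positivity), inv_mul_cancel₀ (by positivity), ENNReal.ofReal_one]

theorem circleMeasure_absolutelyContinuous : circleMeasure ≪ volume :=
  Measure.absolutelyContinuous_of_le Measure.restrict_le_self |>.smul_left _

theorem circleAverage_eq_integral {E : Type*} [NormedAddCommGroup E] [NormedSpace ℝ E]
    (f : ℂ → E) (r : ℝ) :
    Real.circleAverage f 0 r = ∫ θ, f (circleMap 0 r θ) ∂circleMeasure := by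
  rw [Real.circleAverage_def, circleMeasure, integral_smul_measure,
    ENNReal.toReal_ofReal (by positivity), intervalIntegral.integral_of_le (by positivity)]

theorem inv_two_pi_I_mul_circleIntegral (f : ℂ → ℂ) :
    (2 * (Real.pi : ℂ) * Complex.I)⁻¹ * (∮ ζ in C(0, 1), f ζ) =
      ∫ θ, circleMap 0 1 θ * f (circleMap 0 1 θ) ∂circleMeasure := by
  rw [← circleAverage_eq_integral (fun z => z * f z),
    Real.circleAverage_eq_circleIntegral one_ne_zero, smul_eq_mul]
  congr 1
  refine circleIntegral.integral_congr zero_le_one fun z hz => ?_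
  have hz0 : z ≠ 0 := ne_zero_of_mem_unit_sphere ⟨z, hz⟩
  simp [hz0]

theorem exists_seq_tendsto_nhdsLT_one :
    ∃ r : ℕ → ℝ, (∀ n, r n ∈ Ioo (0 : ℝ) 1) ∧ Tendsto r atTop (𝓝[<] 1) := by
  obtain ⟨r, -, hr, hlim⟩ := exists_seq_strictMono_tendsto' (zero_lt_one (α := ℝ))
  exact ⟨r, hr, tendsto_nhdsWithin_iff.2 ⟨hlim, Eventually.of_forall fun n => (hr n).2⟩⟩

theorem circleMap_mem_unitBall {r : ℝ} (hr : r ∈ Ioo (0 : ℝ) 1) (θ : ℝ) :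
    circleMap 0 r θ ∈ Metric.ball (0 : ℂ) 1 := by
  simpa [abs_of_pos hr.1] using hr.2

theorem norm_circleMap_one (θ : ℝ) : ‖circleMap 0 1 θ‖ = 1 := by simp

theorem HasNontangentialLimit.tendsto_radial {f : ℂ → ℂ} {θ : ℝ} {c : ℂ}
    (h : HasNontangentialLimit f (circleMap 0 1 θ) c) :
    Tendsto (fun r => f (circleMap 0 r θ)) (𝓝[<] 1) (𝓝 c) := by
  refine (h 2 one_lt_two).comp (tendsto_nhdsWithin_iff.2 ⟨?_, ?_⟩)
  · have hc : Continuous fun r : ℝ => circleMap 0 r θ := by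
      unfold circleMap
      fun_prop
    exact (hc.tendsto 1).mono_left nhdsWithin_le_nhds
  · filter_upwards [Ioo_mem_nhdsLT zero_lt_one] with r hr
    have hsub : circleMap 0 r θ - circleMap 0 1 θ = ((r - 1 : ℝ) : ℂ) * circleMap 0 1 θ := by
      simp only [circleMap, Complex.ofReal_sub, Complex.ofReal_one]
      ring
    refine ⟨mem_ball_zero_iff.1 (circleMap_mem_unitBall hr θ), ?_⟩
    rw [hsub, norm_mul, norm_circleMap_one, norm_circleMap_zero, Complex.norm_real,
      Real.norm_eq_abs, abs_of_neg (by linarith [hr.2]), abs_of_pos hr.1]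
    linarith [hr.2]

namespace IsBoundaryFunction

variable {f F F' g G φ : ℂ → ℂ}

theorem ae_tendsto_radial (h : IsBoundaryFunction f F) {r : ℕ → ℝ}
    (hr : Tendsto r atTop (𝓝[<] 1)) :
    ∀ᵐ θ ∂circleMeasure, Tendsto (fun n => f (circleMap 0 (r n) θ)) atTop
      (𝓝 (F (circleMap 0 1 θ))) :=
  circleMeasure_absolutelyContinuous.ae_le (h.mono fun _ hθ => hθ.tendsto_radial.comp hr)

theorem ae_eq (h : IsBoundaryFunction f F) (h' : IsBoundaryFunction f F') :
    ∀ᵐ θ : ℝ, F (circleMap 0 1 θ) = F' (circleMap 0 1 θ) := by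
  filter_upwards [h, h'] with θ hθ hθ'
  exact tendsto_nhds_unique hθ.tendsto_radial hθ'.tendsto_radial

theorem mul (hf : IsBoundaryFunction f F) (hg : IsBoundaryFunction g G) :
    IsBoundaryFunction (fun z => f z * g z) (fun z => F z * G z) := by
  filter_upwards [hf, hg] with θ hfθ hgθ M hM
  exact (hfθ M hM).mul (hgθ M hM)

theorem pow (hf : IsBoundaryFunction f F) (n : ℕ) :
    IsBoundaryFunction (fun z => f z ^ n) (fun z => F z ^ n) := by
  filter_upwards [hf] with θ hfθ M hM
  exact (hfθ M hM).pow n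

theorem of_continuousAt (hφ : ∀ w : ℂ, ‖w‖ = 1 → ContinuousAt φ w) : IsBoundaryFunction φ φ :=
  Eventually.of_forall fun θ _ _ =>
    (hφ _ (norm_circleMap_one θ)).tendsto.mono_left nhdsWithin_le_nhds

end IsBoundaryFunction

section Dilations

variable {f F : ℂ → ℂ} {r : ℝ}

theorem continuous_comp_circleMap (hf : DifferentiableOn ℂ f (Metric.ball 0 1))
    (hr : r ∈ Ioo (0 : ℝ) 1) : Continuous fun θ => f (circleMap 0 r θ) :=
  hf.continuousOn.comp_continuous (continuous_circleMap 0 r) (circleMap_mem_unitBall hr)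

theorem memLp_comp_circleMap (hf : DifferentiableOn ℂ f (Metric.ball 0 1))
    (hr : r ∈ Ioo (0 : ℝ) 1) (p : ℝ≥0∞) :
    MemLp (fun θ => f (circleMap 0 r θ)) p circleMeasure := by
  have hc := continuous_comp_circleMap hf hr
  obtain ⟨C, hC⟩ := (((periodic_circleMap 0 r).comp f).isBounded_of_continuous
    (by positivity) hc).exists_norm_le
  exact MemLp.of_bound hc.aestronglyMeasurable C
    (Eventually.of_forall fun θ => hC _ (mem_range_self θ))

theorem IsBoundaryFunction.aestronglyMeasurable (hf : DifferentiableOn ℂ f (Metric.ball 0 1))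
    (h : IsBoundaryFunction f F) :
    AEStronglyMeasurable (fun θ => F (circleMap 0 1 θ)) circleMeasure := by
  obtain ⟨r, hr, hr1⟩ := exists_seq_tendsto_nhdsLT_one
  exact aestronglyMeasurable_of_tendsto_ae atTop
    (fun n => (continuous_comp_circleMap hf (hr n)).aestronglyMeasurable)
    (h.ae_tendsto_radial hr1)

/-- Cauchy's formula for `f` at `r * w`, on the circle of radius `r` rescaled to the unit circle so
that the kernel does not depend on `r`. -/
theorem integral_div_sub_mul_comp_circleMap (hf : DifferentiableOn ℂ f (Metric.ball 0 1))
    (hr : r ∈ Ioo (0 : ℝ) 1) {w : ℂ} (hw : w ∈ Metric.ball (0 : ℂ) 1) :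
    ∫ θ, circleMap 0 1 θ / (circleMap 0 1 θ - w) * f (circleMap 0 r θ) ∂circleMeasure =
      f (r * w) := by
  have hd : DiffContOnCl ℂ f (Metric.ball 0 |r|) := by
    refine hf.diffContOnCl_ball ?_
    rw [abs_of_pos hr.1]
    exact Metric.closedBall_subset_ball hr.2
  have hrw : (r : ℂ) * w ∈ Metric.ball (0 : ℂ) |r| := by
    rw [mem_ball_zero_iff, norm_mul, Complex.norm_real, Real.norm_eq_abs]
    exact mul_lt_of_lt_one_right (abs_pos.2 hr.1.ne') (mem_ball_zero_iff.1 hw)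
  rw [← hd.circleAverage_smul_div hrw, circleAverage_eq_integral]
  congr 1 with θ
  have hr0 : (r : ℂ) ≠ 0 := Complex.ofReal_ne_zero.2 hr.1.ne'
  have hcircle : circleMap 0 r θ = r * circleMap 0 1 θ := by simp [circleMap_zero]
  rw [smul_eq_mul, sub_zero, hcircle, ← mul_sub, mul_div_mul_left _ _ hr0]

theorem integral_comp_circleMap (hf : DifferentiableOn ℂ f (Metric.ball 0 1))
    (hr : r ∈ Ioo (0 : ℝ) 1) : ∫ θ, f (circleMap 0 r θ) ∂circleMeasure = f 0 := by
  simpa using integral_div_sub_mul_comp_circleMap hf hr (Metric.mem_ball_self one_pos)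

end Dilations

theorem norm_circleMap_div_sub_le {w : ℂ} (hw : w ∈ Metric.ball (0 : ℂ) 1) (θ : ℝ) :
    ‖circleMap 0 1 θ / (circleMap 0 1 θ - w)‖ ≤ (1 - ‖w‖)⁻¹ := by
  have hpos : 0 < 1 - ‖w‖ := sub_pos.2 (mem_ball_zero_iff.1 hw)
  have hle : 1 - ‖w‖ ≤ ‖circleMap 0 1 θ - w‖ := by
    simpa only [norm_circleMap_one] using norm_sub_norm_le (circleMap 0 1 θ) w
  rw [norm_div, norm_circleMap_one, one_div]
  exact inv_anti₀ hpos hle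

theorem sSup_integralMeans_nonneg (q : ℝ) (f : ℂ → ℂ) : 0 ≤ sSup (integralMeans q f) := by
  refine Real.sSup_nonneg ?_
  rintro _ ⟨r, -, rfl⟩
  simp only [circleAverage_eq_integral]
  exact integral_nonneg fun θ => by positivity

theorem hardyNorm_nonneg (q : ℝ) (f : ℂ → ℂ) : 0 ≤ hardyNorm q f :=
  Real.rpow_nonneg (sSup_integralMeans_nonneg q f) _

theorem memHardy_of_integral_le {q C : ℝ} {f : ℂ → ℂ}
    (hf : DifferentiableOn ℂ f (Metric.ball 0 1))
    (h : ∀ r ∈ Ioo (0 : ℝ) 1, ∫ θ, ‖f (circleMap 0 r θ)‖ ^ q ∂circleMeasure ≤ C) :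
    MemHardy q f ∧ sSup (integralMeans q f) ≤ C := by
  have hle : ∀ x ∈ integralMeans q f, x ≤ C := by
    rintro _ ⟨r, hr, rfl⟩
    simpa only [circleAverage_eq_integral] using h r hr
  exact ⟨⟨hf, C, hle⟩, csSup_le ((nonempty_Ioo.2 zero_lt_one).image _) hle⟩

theorem memHardy_of_bounded {q C : ℝ} (hq : 0 ≤ q) {f : ℂ → ℂ}
    (hf : DifferentiableOn ℂ f (Metric.ball 0 1))
    (hC : ∀ z ∈ Metric.ball (0 : ℂ) 1, ‖f z‖ ≤ C) : MemHardy q f := by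
  refine (memHardy_of_integral_le (C := C ^ q) hf fun r hr => ?_).1
  calc ∫ θ, ‖f (circleMap 0 r θ)‖ ^ q ∂circleMeasure ≤ ∫ _, C ^ q ∂circleMeasure :=
        integral_mono_of_nonneg (Eventually.of_forall fun θ => by positivity) (integrable_const _)
          (Eventually.of_forall fun θ =>
            Real.rpow_le_rpow (norm_nonneg _) (hC _ (circleMap_mem_unitBall hr θ)) hq)
    _ = C ^ q := by simp

namespace MemHardy

variable {q p : ℝ} {f F g : ℂ → ℂ}

theorem mul_bounded (hq : 0 ≤ q) (hf : MemHardy q f)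
    (hg : DifferentiableOn ℂ g (Metric.ball 0 1)) {C : ℝ}
    (hC : ∀ z ∈ Metric.ball (0 : ℂ) 1, ‖g z‖ ≤ C) : MemHardy q (fun z => f z * g z) := by
  obtain ⟨B, hB⟩ := hf.2
  have hC0 : 0 ≤ C := (norm_nonneg _).trans (hC 0 (Metric.mem_ball_self one_pos))
  refine (memHardy_of_integral_le (C := C ^ q * B) (hf.1.mul hg) fun r hr => ?_).1
  have hi : Integrable (fun θ => ‖f (circleMap 0 r θ)‖ ^ q) circleMeasure := by
    have := (memLp_comp_circleMap hf.1 hr (ENNReal.ofReal q)).integrable_norm_rpow'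
    rwa [ENNReal.toReal_ofReal hq] at this
  calc ∫ θ, ‖f (circleMap 0 r θ) * g (circleMap 0 r θ)‖ ^ q ∂circleMeasure
      ≤ ∫ θ, C ^ q * ‖f (circleMap 0 r θ)‖ ^ q ∂circleMeasure := by
        refine integral_mono_of_nonneg (Eventually.of_forall fun θ => by positivity)
          (hi.const_mul _) (Eventually.of_forall fun θ => ?_)
        simp only
        rw [norm_mul, Real.mul_rpow (norm_nonneg _) (norm_nonneg _), mul_comm]
        gcongr
        exact hC _ (circleMap_mem_unitBall hr θ)
    _ ≤ C ^ q * B := by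
        rw [integral_const_mul, ← circleAverage_eq_integral (fun z => ‖f z‖ ^ q)]
        gcongr
        exact hB ⟨r, hr, rfl⟩

theorem eLpNorm_comp_circleMap_le (hq : 0 < q) (hf : MemHardy q f) {r : ℝ}
    (hr : r ∈ Ioo (0 : ℝ) 1) :
    eLpNorm (fun θ => f (circleMap 0 r θ)) (ENNReal.ofReal q) circleMeasure ≤
      ENNReal.ofReal (hardyNorm q f) := by
  rw [(memLp_comp_circleMap hf.1 hr _).eLpNorm_eq_integral_rpow_norm (by simpa using hq)
    ENNReal.ofReal_ne_top, ENNReal.toReal_ofReal hq.le, hardyNorm, one_div,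
    ← circleAverage_eq_integral (fun z => ‖f z‖ ^ q)]
  gcongr
  · rw [circleAverage_eq_integral]
    exact integral_nonneg fun θ => by positivity
  · exact le_csSup hf.2 ⟨r, hr, rfl⟩

theorem eLpNorm_boundary_le (hq : 0 < q) (hf : MemHardy q f) (h : IsBoundaryFunction f F) :
    eLpNorm (fun θ => F (circleMap 0 1 θ)) (ENNReal.ofReal q) circleMeasure ≤
      ENNReal.ofReal (hardyNorm q f) := by
  obtain ⟨r, hr, hr1⟩ := exists_seq_tendsto_nhdsLT_one
  exact Lp.eLpNorm_le_of_ae_tendsto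
    (Eventually.of_forall fun n => hf.eLpNorm_comp_circleMap_le hq (hr n))
    (fun n => (continuous_comp_circleMap hf.1 (hr n)).aestronglyMeasurable)
    (h.ae_tendsto_radial hr1)

theorem memLp_boundary (hq : 0 < q) (hf : MemHardy q f) (h : IsBoundaryFunction f F) :
    MemLp (fun θ => F (circleMap 0 1 θ)) (ENNReal.ofReal q) circleMeasure :=
  ⟨h.aestronglyMeasurable hf.1, (hf.eLpNorm_boundary_le hq h).trans_lt ENNReal.ofReal_lt_top⟩

theorem integrable_boundary (hq : 1 ≤ q) (hf : MemHardy q f) (h : IsBoundaryFunction f F) :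
    Integrable (fun θ => F (circleMap 0 1 θ)) circleMeasure :=
  (hf.memLp_boundary (one_pos.trans_le hq) h).integrable (ENNReal.one_le_ofReal.2 hq)

theorem integral_div_sub_mul_boundary (hq : 1 < q) (hf : MemHardy q f)
    (h : IsBoundaryFunction f F) {w : ℂ} (hw : w ∈ Metric.ball (0 : ℂ) 1) :
    ∫ θ, circleMap 0 1 θ / (circleMap 0 1 θ - w) * F (circleMap 0 1 θ) ∂circleMeasure = f w := by
  obtain ⟨r, hr, hr1⟩ := exists_seq_tendsto_nhdsLT_one
  set k : ℝ → ℂ := fun θ => circleMap 0 1 θ / (circleMap 0 1 θ - w)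
  have hk : Measurable k :=
    (continuous_circleMap 0 1).measurable.div ((continuous_circleMap 0 1).measurable.sub_const w)
  have hbound n : eLpNorm (fun θ => k θ * f (circleMap 0 (r n) θ)) (ENNReal.ofReal q)
      circleMeasure ≤ ENNReal.ofReal (1 - ‖w‖)⁻¹ * ENNReal.ofReal (hardyNorm q f) := by
    refine (eLpNorm_le_mul_eLpNorm_of_ae_le_mul (Eventually.of_forall fun θ => ?_) _).trans
      (mul_le_mul_right (hf.eLpNorm_comp_circleMap_le (one_pos.trans hq) (hr n)) _)
    rw [norm_mul]
    exact mul_le_mul_of_nonneg_right (norm_circleMap_div_sub_le hw θ) (norm_nonneg _)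
  have hboundary : Tendsto (fun n => ∫ θ, k θ * f (circleMap 0 (r n) θ) ∂circleMeasure) atTop
      (𝓝 (∫ θ, k θ * F (circleMap 0 1 θ) ∂circleMeasure)) := by
    refine tendsto_integral_of_tendsto_ae_of_eLpNorm_le (ENNReal.one_lt_ofReal.2 hq) (fun n => ?_)
      (by finiteness) hbound ((h.ae_tendsto_radial hr1).mono fun θ hθ => hθ.const_mul (k θ))
    exact hk.aestronglyMeasurable.mul
      (continuous_comp_circleMap hf.1 (hr n)).aestronglyMeasurable
  have hinterior : Tendsto (fun n => f (r n * w)) atTop (𝓝 (f w)) := by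
    have hfw : ContinuousAt f w := hf.1.continuousOn.continuousAt (Metric.isOpen_ball.mem_nhds hw)
    refine hfw.tendsto.comp ?_
    simpa using ((Complex.continuous_ofReal.tendsto 1).comp
      (hr1.mono_right nhdsWithin_le_nhds)).mul_const w
  refine tendsto_nhds_unique hboundary (hinterior.congr fun n => ?_)
  exact (integral_div_sub_mul_comp_circleMap hf.1 (hr n) hw).symm

theorem integral_boundary (hq : 1 < q) (hf : MemHardy q f) (h : IsBoundaryFunction f F) :
    ∫ θ, F (circleMap 0 1 θ) ∂circleMeasure = f 0 := by
  simpa using hf.integral_div_sub_mul_boundary hq h (Metric.mem_ball_self one_pos)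

theorem norm_integral_boundary_mul_le (hpq : q.HolderConjugate p) (hf : MemHardy q f)
    (h : IsBoundaryFunction f F) {u : ℝ → ℂ} (hu : MemLp u (ENNReal.ofReal p) circleMeasure) :
    ‖∫ θ, F (circleMap 0 1 θ) * u θ ∂circleMeasure‖ ≤
      hardyNorm q f * (∫ θ, ‖u θ‖ ^ p ∂circleMeasure) ^ (1 / p) := by
  have hF := hf.memLp_boundary hpq.pos h
  have hFnorm : (∫ θ, ‖F (circleMap 0 1 θ)‖ ^ q ∂circleMeasure) ^ (1 / q) ≤ hardyNorm q f := by
    have hle := hf.eLpNorm_boundary_le hpq.pos h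
    rwa [hF.eLpNorm_eq_integral_rpow_norm (by simpa using hpq.pos) ENNReal.ofReal_ne_top,
      ENNReal.toReal_ofReal hpq.pos.le, ← one_div,
      ENNReal.ofReal_le_ofReal_iff (hardyNorm_nonneg q f)] at hle
  calc ‖∫ θ, F (circleMap 0 1 θ) * u θ ∂circleMeasure‖
      ≤ ∫ θ, ‖F (circleMap 0 1 θ)‖ * ‖u θ‖ ∂circleMeasure := by
        simpa only [norm_mul] using
          norm_integral_le_integral_norm fun θ => F (circleMap 0 1 θ) * u θ
    _ ≤ (∫ θ, ‖F (circleMap 0 1 θ)‖ ^ q ∂circleMeasure) ^ (1 / q) *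
        (∫ θ, ‖u θ‖ ^ p ∂circleMeasure) ^ (1 / p) := integral_mul_norm_le_Lp_mul_Lq hpq hF hu
    _ ≤ hardyNorm q f * (∫ θ, ‖u θ‖ ^ p ∂circleMeasure) ^ (1 / p) := by gcongr

end MemHardy

theorem le_of_forall_pow_le_const_mul_pow {a b C : ℝ} (hb : 0 ≤ b)
    (h : ∀ n : ℕ, a ^ n ≤ C * b ^ n) : a ≤ b := by
  by_contra! hlt
  have ha : 0 < a := hb.trans_lt hlt
  have hC : 0 < C := by linarith [h 0, pow_zero a, pow_zero b]
  obtain ⟨n, hn⟩ := exists_pow_lt_of_lt_one (inv_pos.2 hC) ((div_lt_one ha).2 hlt)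
  rw [div_pow, div_lt_iff₀ (pow_pos ha n), ← div_eq_inv_mul, lt_div_iff₀ hC] at hn
  linarith [h n]

/-- Cauchy's formula for the powers of `f` gives `‖f w‖ ^ n ≤ (1 - ‖w‖)⁻¹ * M ^ n` for all `n`,
where the constant `(1 - ‖w‖)⁻¹` is irrelevant. -/
theorem norm_le_of_ae_norm_boundary_le {f F : ℂ → ℂ} {C M : ℝ}
    (hf : DifferentiableOn ℂ f (Metric.ball 0 1))
    (hC : ∀ z ∈ Metric.ball (0 : ℂ) 1, ‖f z‖ ≤ C) (hF : IsBoundaryFunction f F)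
    (hM : ∀ᵐ θ ∂circleMeasure, ‖F (circleMap 0 1 θ)‖ ≤ M) {w : ℂ}
    (hw : w ∈ Metric.ball (0 : ℂ) 1) : ‖f w‖ ≤ M := by
  have hM0 : 0 ≤ M := hM.exists.elim fun _ hθ => (norm_nonneg _).trans hθ
  refine le_of_forall_pow_le_const_mul_pow (C := (1 - ‖w‖)⁻¹) hM0 fun n => ?_
  have hfn : MemHardy 2 fun z => f z ^ n :=
    memHardy_of_bounded (C := C ^ n) zero_le_two (hf.pow n) fun z hz => by
      simpa only [norm_pow] using pow_le_pow_left₀ (norm_nonneg _) (hC z hz) n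
  rw [← norm_pow, ← hfn.integral_div_sub_mul_boundary one_lt_two (hF.pow n) hw]
  refine (norm_integral_le_of_norm_le_const ?_).trans_eq (by rw [probReal_univ, mul_one])
  filter_upwards [hM] with θ hθ
  rw [norm_mul, norm_pow]
  exact mul_le_mul (norm_circleMap_div_sub_le hw θ) (pow_le_pow_left₀ (norm_nonneg _) hθ n)
    (by positivity) (inv_nonneg.2 (sub_nonneg.2 (mem_ball_zero_iff.1 hw).le))

namespace IsInner

variable {J J' F φ g G : ℂ → ℂ} {q : ℝ}

theorem ae_norm_eq_one (hJ : IsInner J) (hF : IsBoundaryFunction J F) :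
    ∀ᵐ θ : ℝ, ‖F (circleMap 0 1 θ)‖ = 1 := by
  obtain ⟨F', hF', hF'1⟩ := hJ.2.2
  filter_upwards [hF.ae_eq hF', hF'1] with θ hθ hθ1
  rw [hθ, hθ1]

theorem ae_circleMeasure_norm_eq_one (hJ : IsInner J) (hF : IsBoundaryFunction J F) :
    ∀ᵐ θ ∂circleMeasure, ‖F (circleMap 0 1 θ)‖ = 1 :=
  circleMeasure_absolutelyContinuous.ae_le (hJ.ae_norm_eq_one hF)

theorem mul (hJ : IsInner J) (hJ' : IsInner J') : IsInner fun z => J z * J' z := by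
  obtain ⟨hd, ⟨C, hC⟩, F, hF, hF1⟩ := hJ
  obtain ⟨hd', ⟨C', hC'⟩, F', hF', hF'1⟩ := hJ'
  refine ⟨hd.mul hd', ⟨C * C', fun z hz => ?_⟩, fun z => F z * F' z, hF.mul hF', ?_⟩
  · rw [norm_mul]
    exact mul_le_mul (hC z hz) (hC' z hz) (norm_nonneg _) ((norm_nonneg _).trans (hC z hz))
  · filter_upwards [hF1, hF'1] with θ hθ hθ'
    rw [norm_mul, hθ, hθ', one_mul]

theorem mapsTo_closedBall (hJ : IsInner J) :
    MapsTo J (Metric.ball 0 1) (Metric.closedBall 0 1) := fun z hz => by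
  obtain ⟨C, hC⟩ := hJ.2.1
  obtain ⟨F, hF, -⟩ := hJ.2.2
  exact mem_closedBall_zero_iff.2 (norm_le_of_ae_norm_boundary_le hJ.1 hC hF
    ((hJ.ae_circleMeasure_norm_eq_one hF).mono fun _ hθ => hθ.le) hz)

theorem norm_zero_lt_one (hJ : IsInner J) (hc : ¬ IsConstantOnDisk J) : ‖J 0‖ < 1 := by
  have h0 : (0 : ℂ) ∈ Metric.ball (0 : ℂ) 1 := Metric.mem_ball_self one_pos
  have hle {z : ℂ} (hz : z ∈ Metric.ball (0 : ℂ) 1) : ‖J z‖ ≤ 1 :=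
    mem_closedBall_zero_iff.1 (hJ.mapsTo_closedBall hz)
  refine (hle h0).lt_of_ne fun heq => hc ⟨J 0, ?_⟩
  refine Complex.eqOn_of_isPreconnected_of_isMaxOn_norm
    (convex_ball (0 : ℂ) 1).isPreconnected Metric.isOpen_ball hJ.1 h0 fun z hz => ?_
  simpa only [mem_ofPred_eq, Function.comp_apply, heq] using hle hz

theorem differentiableOn_comp (hJ : IsInner J)
    (hφ : AnalyticOnNhd ℂ φ (Metric.closedBall 0 1)) :
    DifferentiableOn ℂ (fun z => φ (J z)) (Metric.ball 0 1) :=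
  hφ.differentiableOn.comp hJ.1 hJ.mapsTo_closedBall

theorem exists_norm_comp_le (hJ : IsInner J)
    (hφ : AnalyticOnNhd ℂ φ (Metric.closedBall 0 1)) :
    ∃ C, ∀ z ∈ Metric.ball (0 : ℂ) 1, ‖φ (J z)‖ ≤ C := by
  obtain ⟨C, hC⟩ := (isCompact_closedBall (0 : ℂ) 1).exists_bound_of_continuousOn hφ.continuousOn
  exact ⟨C, fun z hz => hC _ (hJ.mapsTo_closedBall hz)⟩

theorem isBoundaryFunction_comp (hJ : IsInner J) (hF : IsBoundaryFunction J F)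
    (hφ : AnalyticOnNhd ℂ φ (Metric.closedBall 0 1)) :
    IsBoundaryFunction (fun z => φ (J z)) fun z => φ (F z) := by
  filter_upwards [hF, hJ.ae_norm_eq_one hF] with θ hθ hθ1 M hM
  exact (hφ _ (mem_closedBall_zero_iff.2 hθ1.le)).continuousAt.tendsto.comp (hθ M hM)

theorem memHardy_comp (hJ : IsInner J) (hφ : AnalyticOnNhd ℂ φ (Metric.closedBall 0 1))
    (hq : 0 ≤ q) : MemHardy q fun z => φ (J z) := by
  obtain ⟨C, hC⟩ := hJ.exists_norm_comp_le hφ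
  exact memHardy_of_bounded hq (hJ.differentiableOn_comp hφ) hC

theorem integrable_comp (hJ : IsInner J) (hF : IsBoundaryFunction J F)
    (hφ : AnalyticOnNhd ℂ φ (Metric.closedBall 0 1)) :
    Integrable (fun θ => φ (F (circleMap 0 1 θ))) circleMeasure :=
  (hJ.memHardy_comp hφ zero_le_one).integrable_boundary le_rfl (hJ.isBoundaryFunction_comp hF hφ)

theorem integral_comp (hJ : IsInner J) (hF : IsBoundaryFunction J F)
    (hφ : AnalyticOnNhd ℂ φ (Metric.closedBall 0 1)) :
    ∫ θ, φ (F (circleMap 0 1 θ)) ∂circleMeasure = φ (J 0) :=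
  (hJ.memHardy_comp hφ zero_le_two).integral_boundary one_lt_two (hJ.isBoundaryFunction_comp hF hφ)

theorem memHardy_mul_id_mul_comp (hJ : IsInner J)
    (hφ : AnalyticOnNhd ℂ φ (Metric.closedBall 0 1)) (hq : 0 ≤ q) (hg : MemHardy q g) :
    MemHardy q fun z => g z * (z * φ (J z)) := by
  obtain ⟨C, hC⟩ := hJ.exists_norm_comp_le hφ
  refine hg.mul_bounded hq (differentiableOn_id.mul (hJ.differentiableOn_comp hφ)) (C := 1 * C)
    fun z hz => ?_
  rw [norm_mul]
  exact mul_le_mul (mem_ball_zero_iff.1 hz).le (hC z hz) (norm_nonneg _) zero_le_one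

theorem isBoundaryFunction_mul_id_mul_comp (hJ : IsInner J) (hF : IsBoundaryFunction J F)
    (hφ : AnalyticOnNhd ℂ φ (Metric.closedBall 0 1)) (hG : IsBoundaryFunction g G) :
    IsBoundaryFunction (fun z => g z * (z * φ (J z))) fun z => G z * (z * φ (F z)) :=
  hG.mul ((IsBoundaryFunction.of_continuousAt (φ := fun z => z) fun _ _ => continuousAt_id).mul
    (hJ.isBoundaryFunction_comp hF hφ))

/-- On the circle `conj J * φ(J) = φ 0 * conj J + dslope φ 0 (J)`, and the second summand is
analytic in the disk, hence invisible to `g`. -/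
theorem integral_mul_conj_mul_comp (hJ : IsInner J) (hF : IsBoundaryFunction J F)
    (hφ : AnalyticOnNhd ℂ φ (Metric.closedBall 0 1)) (hq : 1 < q) (hg : MemHardy q g)
    (hG : IsBoundaryFunction g G) :
    ∫ θ, G (circleMap 0 1 θ) * (circleMap 0 1 θ *
        (conj (F (circleMap 0 1 θ)) * φ (F (circleMap 0 1 θ)))) ∂circleMeasure =
      φ 0 * ∫ θ, circleMap 0 1 θ *
        (G (circleMap 0 1 θ) * conj (F (circleMap 0 1 θ))) ∂circleMeasure := by
  set X := dslope φ 0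
  have hX : AnalyticOnNhd ℂ X (Metric.closedBall 0 1) :=
    analyticOnNhd_dslope (Metric.mem_closedBall_self zero_le_one) hφ
  have hgX := hJ.memHardy_mul_id_mul_comp hX (zero_le_one.trans hq.le) hg
  have hGX := hJ.isBoundaryFunction_mul_id_mul_comp hF hX hG
  have hX0 : ∫ θ, G (circleMap 0 1 θ) * (circleMap 0 1 θ * X (F (circleMap 0 1 θ)))
      ∂circleMeasure = 0 := by
    simpa using hgX.integral_boundary hq hGX
  have hGF : Integrable (fun θ => circleMap 0 1 θ *
      (G (circleMap 0 1 θ) * conj (F (circleMap 0 1 θ)))) circleMeasure := by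
    have hGi := hg.integrable_boundary hq.le hG
    refine hGi.mono ?_ ?_
    · exact (continuous_circleMap 0 1).aestronglyMeasurable.mul
        (hGi.1.mul (Complex.continuous_conj.comp_aestronglyMeasurable
          (hF.aestronglyMeasurable hJ.1)))
    · filter_upwards [hJ.ae_circleMeasure_norm_eq_one hF] with θ hθ
      rw [norm_mul, norm_mul, RCLike.norm_conj, hθ, norm_circleMap_one, one_mul, mul_one]
  calc _ = ∫ θ, (φ 0 * (circleMap 0 1 θ *
          (G (circleMap 0 1 θ) * conj (F (circleMap 0 1 θ)))) +
        G (circleMap 0 1 θ) * (circleMap 0 1 θ * X (F (circleMap 0 1 θ)))) ∂circleMeasure := by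
        refine integral_congr_ae ?_
        filter_upwards [hJ.ae_circleMeasure_norm_eq_one hF] with θ hθ
        rw [conj_mul_eq_of_norm_eq_one φ hθ]
        ring
    _ = _ := by
        rw [integral_add (hGF.const_mul _) (hgX.integrable_boundary hq.le hGX),
          integral_const_mul, hX0, add_zero]

theorem integral_sub_mul_conj_mul_comp (hJ : IsInner J) (hF : IsBoundaryFunction J F)
    (hφ : AnalyticOnNhd ℂ φ (Metric.closedBall 0 1)) :
    ∫ θ, (F (circleMap 0 1 θ) - J 0) *
        (conj (F (circleMap 0 1 θ)) * φ (F (circleMap 0 1 θ))) ∂circleMeasure =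
      (1 - ‖J 0‖ ^ 2) * φ 0 := by
  set X := dslope φ 0
  have hX : AnalyticOnNhd ℂ X (Metric.closedBall 0 1) :=
    analyticOnNhd_dslope (Metric.mem_closedBall_self zero_le_one) hφ
  have hFc : Integrable (fun θ => φ 0 * conj (F (circleMap 0 1 θ))) circleMeasure :=
    (Complex.conjCLE.toContinuousLinearMap.integrable_comp
      (hJ.integrable_comp hF analyticOnNhd_id)).const_mul _
  have hFX := hJ.integrable_comp hF hX
  calc _ = ∫ θ, (φ (F (circleMap 0 1 θ)) -
        J 0 * (φ 0 * conj (F (circleMap 0 1 θ)) + X (F (circleMap 0 1 θ)))) ∂circleMeasure := by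
        refine integral_congr_ae ?_
        filter_upwards [hJ.ae_circleMeasure_norm_eq_one hF] with θ hθ
        have hFF : F (circleMap 0 1 θ) * conj (F (circleMap 0 1 θ)) = 1 := by
          rw [Complex.mul_conj', hθ]
          simp
        simp only [X]
        rw [← conj_mul_eq_of_norm_eq_one φ hθ]
        linear_combination φ (F (circleMap 0 1 θ)) * hFF
    _ = φ (J 0) - J 0 * (φ 0 * conj (J 0) + X (J 0)) := by
        have hconj : ∫ θ, conj (F (circleMap 0 1 θ)) ∂circleMeasure = conj (J 0) := by
          rw [integral_conj]
          exact congrArg conj (hJ.integral_comp hF analyticOnNhd_id)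
        have hsum : Integrable (fun θ => φ 0 * conj (F (circleMap 0 1 θ)) +
            X (F (circleMap 0 1 θ))) circleMeasure := hFc.add hFX
        rw [integral_sub (hJ.integrable_comp hF hφ) (hsum.const_mul _),
          integral_const_mul, integral_add hFc hFX, integral_const_mul, hconj,
          hJ.integral_comp hF hφ, hJ.integral_comp hF hX]
    _ = (1 - ‖J 0‖ ^ 2) * φ 0 := by
        rw [← Complex.mul_conj']
        linear_combination eq_add_mul_dslope_zero φ (J 0)

theorem integral_norm_kernelPow_rpow_le (hJ : IsInner J) (hF : IsBoundaryFunction J F) {p : ℝ}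
    (hp : p ≠ 0) :
    ∫ θ, ‖kernelPow (J 0) (2 / p) (F (circleMap 0 1 θ))‖ ^ p ∂circleMeasure ≤ 1 - ‖J 0‖ ^ 2 := by
  have hmean : ∫ θ, F (circleMap 0 1 θ) ∂circleMeasure = J 0 :=
    hJ.integral_comp hF analyticOnNhd_id
  have hle := integral_norm_one_sub_conj_mul_sq_le (hF.aestronglyMeasurable hJ.1)
    ((hJ.ae_circleMeasure_norm_eq_one hF).mono fun _ hθ => hθ.le)
  simpa only [norm_kernelPow, ← Real.rpow_mul (norm_nonneg _), div_mul_cancel₀ _ hp,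
    Real.rpow_two, hmean] using hle

theorem integral_norm_dilation_sq_le (hJ : IsInner J) {r : ℝ} (hr : r ∈ Ioo (0 : ℝ) 1) :
    ∫ θ, ‖1 - conj (J 0) * J (circleMap 0 r θ)‖ ^ 2 ∂circleMeasure ≤ 1 - ‖J 0‖ ^ 2 := by
  simpa only [integral_comp_circleMap hJ.1 hr] using integral_norm_one_sub_conj_mul_sq_le
    (μ := circleMeasure) (continuous_comp_circleMap hJ.1 hr).aestronglyMeasurable
    (Eventually.of_forall fun θ =>
      mem_closedBall_zero_iff.1 (hJ.mapsTo_closedBall (circleMap_mem_unitBall hr θ)))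

theorem le_of_mem_dualValues (hJ : IsInner J) (hq : 1 < q) (ha : ‖J 0‖ < 1) {x : ℝ}
    (hx : x ∈ dualValues q J) : x ≤ (1 - ‖J 0‖ ^ 2) ^ (1 - 1 / q) := by
  obtain ⟨g, G, F, hg, hg1, hG, hF, rfl⟩ := hx
  obtain ⟨p, hpq⟩ : ∃ p, q.HolderConjugate p := ⟨_, Real.HolderConjugate.conjExponent hq⟩
  have hp : 1 - 1 / q = 1 / p := by
    rw [one_div, one_div, hpq.one_sub_inv]
  set φ := kernelPow (J 0) (2 / p)
  have hφ : AnalyticOnNhd ℂ φ (Metric.closedBall 0 1) := analyticOnNhd_kernelPow ha _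
  set u : ℝ → ℂ := fun θ => circleMap 0 1 θ *
    (conj (F (circleMap 0 1 θ)) * φ (F (circleMap 0 1 θ)))
  have hunorm : ∀ᵐ θ ∂circleMeasure, ‖u θ‖ = ‖φ (F (circleMap 0 1 θ))‖ := by
    filter_upwards [hJ.ae_circleMeasure_norm_eq_one hF] with θ hθ
    rw [norm_mul, norm_mul, RCLike.norm_conj, hθ, norm_circleMap_one, one_mul, one_mul]
  have hu : MemLp u (ENNReal.ofReal p) circleMeasure := by
    have hφp := (hJ.memHardy_comp hφ hpq.symm.nonneg).memLp_boundary hpq.symm.pos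
      (hJ.isBoundaryFunction_comp hF hφ)
    exact hφp.of_le ((continuous_circleMap 0 1).aestronglyMeasurable.mul
      ((Complex.continuous_conj.comp_aestronglyMeasurable (hF.aestronglyMeasurable hJ.1)).mul
        hφp.1)) (hunorm.mono fun _ hθ => hθ.le)
  have hup : ∫ θ, ‖u θ‖ ^ p ∂circleMeasure ≤ 1 - ‖J 0‖ ^ 2 :=
    (integral_congr_ae (hunorm.mono fun _ hθ => congrArg (· ^ p) hθ)).trans_le
      (hJ.integral_norm_kernelPow_rpow_le hF hpq.symm.ne_zero)
  have htest := hJ.integral_mul_conj_mul_comp hF hφ hq hg hG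
  rw [show φ 0 = 1 from kernelPow_zero _ _, one_mul] at htest
  rw [inv_two_pi_I_mul_circleIntegral, ← htest, hp]
  calc ‖∫ θ, G (circleMap 0 1 θ) * u θ ∂circleMeasure‖
      ≤ hardyNorm q g * (∫ θ, ‖u θ‖ ^ p ∂circleMeasure) ^ (1 / p) :=
        hg.norm_integral_boundary_mul_le hpq hG hu
    _ ≤ 1 * (1 - ‖J 0‖ ^ 2) ^ (1 / p) := by
        have := hpq.symm.one_div_nonneg
        gcongr
    _ = (1 - ‖J 0‖ ^ 2) ^ (1 / p) := one_mul _

end IsInner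

/-- The function attaining the supremum of `dualValues q J` for a non-constant inner function `J`.
It is the equality case in Hölder's inequality, normalized in `H^q`: with `a = J 0`, its modulus on
the circle is `|1 - conj a * J| ^ (2 / q)` up to a constant, as `|J - a| = |1 - conj a * J|`
there. -/
noncomputable def extremal (q : ℝ) (J : ℂ → ℂ) (z : ℂ) : ℂ :=
  ((1 - ‖J 0‖ ^ 2) ^ (-(1 / q)) : ℝ) * (dslope J 0 z * kernelPow (J 0) (2 / q - 1) (J z))

namespace IsInner

variable {J F : ℂ → ℂ} {q : ℝ}

theorem differentiableOn_extremal (hJ : IsInner J) (ha : ‖J 0‖ < 1) :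
    DifferentiableOn ℂ (extremal q J) (Metric.ball 0 1) :=
  (((Complex.differentiableOn_dslope (Metric.ball_mem_nhds 0 one_pos)).2 hJ.1).mul
    (hJ.differentiableOn_comp (analyticOnNhd_kernelPow ha _))).const_mul _

theorem isBoundaryFunction_extremal (hJ : IsInner J) (hF : IsBoundaryFunction J F)
    (ha : ‖J 0‖ < 1) :
    IsBoundaryFunction (extremal q J) fun z =>
      ((1 - ‖J 0‖ ^ 2) ^ (-(1 / q)) : ℝ) *
        ((F z - J 0) / z * kernelPow (J 0) (2 / q - 1) (F z)) := by
  filter_upwards [hF, hJ.isBoundaryFunction_comp hF (analyticOnNhd_kernelPow ha (2 / q - 1))]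
    with θ hFθ hkernel M hM
  have hne : circleMap 0 1 θ ≠ 0 := circleMap_ne_center one_ne_zero
  have hslope : Tendsto (dslope J 0) (𝓝[stolz (circleMap 0 1 θ) M] (circleMap 0 1 θ))
      (𝓝 ((F (circleMap 0 1 θ) - J 0) / circleMap 0 1 θ)) := by
    refine Tendsto.congr' ?_ (((hFθ M hM).sub_const (J 0)).div
      (tendsto_id.mono_left nhdsWithin_le_nhds) hne)
    filter_upwards [nhdsWithin_le_nhds (isOpen_ne.mem_nhds hne)] with z hz
    rw [dslope_of_ne _ hz, slope_def_field, sub_zero]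
    rfl
  exact (hslope.mul (hkernel M hM)).const_mul _

theorem norm_dslope_zero_le (hJ : IsInner J) (ha : ‖J 0‖ < 1) {z : ℂ}
    (hz : z ∈ Metric.ball (0 : ℂ) 1) (hz0 : z ≠ 0) :
    ‖dslope J 0 z‖ ≤ ‖1 - conj (J 0) * J z‖ := by
  rw [dslope_of_ne _ hz0, slope_def_field, sub_zero, norm_div,
    div_le_iff₀ (norm_pos_iff.2 hz0), mul_comm]
  exact schwarz_pick_zero hJ.1 hJ.mapsTo_closedBall ha hz

theorem norm_extremal_rpow_le (hJ : IsInner J) (hq : 0 < q) (ha : ‖J 0‖ < 1) {z : ℂ}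
    (hz : z ∈ Metric.ball (0 : ℂ) 1) (hz0 : z ≠ 0) :
    ‖extremal q J z‖ ^ q ≤ (1 - ‖J 0‖ ^ 2)⁻¹ * ‖1 - conj (J 0) * J z‖ ^ 2 := by
  have hm := one_sub_norm_sq_pos ha
  set m := 1 - ‖J 0‖ ^ 2
  set t := ‖1 - conj (J 0) * J z‖
  have ht : 0 < t := norm_pos_iff.2 (Complex.slitPlane_ne_zero
    (one_sub_conj_mul_mem_slitPlane ha (mem_closedBall_zero_iff.1 (hJ.mapsTo_closedBall hz))))
  calc ‖extremal q J z‖ ^ q = (m ^ (-(1 / q)) * (‖dslope J 0 z‖ * t ^ (2 / q - 1))) ^ q := by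
        rw [extremal, norm_mul, norm_mul, norm_kernelPow, Complex.norm_real,
          Real.norm_of_nonneg (by positivity)]
    _ ≤ (m ^ (-(1 / q)) * (t * t ^ (2 / q - 1))) ^ q := by
        gcongr
        exact hJ.norm_dslope_zero_le ha hz hz0
    _ = (m ^ (-(1 / q)) * t ^ (2 / q)) ^ q := by
        rw [← Real.rpow_one_add' ht.le (by rw [add_sub_cancel]; positivity), add_sub_cancel]
    _ = m⁻¹ * t ^ 2 := by
        rw [Real.mul_rpow (by positivity) (by positivity), ← Real.rpow_mul hm.le,
          ← Real.rpow_mul ht.le, div_mul_cancel₀ _ hq.ne', Real.rpow_two, neg_mul,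
          one_div_mul_cancel hq.ne', Real.rpow_neg_one]

theorem integral_norm_extremal_rpow_le (hJ : IsInner J) (hq : 0 < q) (ha : ‖J 0‖ < 1) {r : ℝ}
    (hr : r ∈ Ioo (0 : ℝ) 1) :
    ∫ θ, ‖extremal q J (circleMap 0 r θ)‖ ^ q ∂circleMeasure ≤ 1 := by
  have hm := one_sub_norm_sq_pos ha
  have hi : Integrable (fun θ => ‖1 - conj (J 0) * J (circleMap 0 r θ)‖ ^ 2) circleMeasure :=
    (memLp_comp_circleMap ((hJ.1.const_mul (conj (J 0))).const_sub 1) hr 2).integrable_norm_pow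
      two_ne_zero
  calc ∫ θ, ‖extremal q J (circleMap 0 r θ)‖ ^ q ∂circleMeasure
      ≤ ∫ θ, (1 - ‖J 0‖ ^ 2)⁻¹ * ‖1 - conj (J 0) * J (circleMap 0 r θ)‖ ^ 2 ∂circleMeasure :=
        integral_mono_of_nonneg (Eventually.of_forall fun θ => by positivity) (hi.const_mul _)
          (Eventually.of_forall fun θ => hJ.norm_extremal_rpow_le hq ha
            (circleMap_mem_unitBall hr θ) (circleMap_ne_center hr.1.ne'))
    _ ≤ (1 - ‖J 0‖ ^ 2)⁻¹ * (1 - ‖J 0‖ ^ 2) := by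
        rw [integral_const_mul]
        gcongr
        exact hJ.integral_norm_dilation_sq_le hr
    _ = 1 := inv_mul_cancel₀ hm.ne'

theorem mem_dualValues (hJ : IsInner J) (hq : 0 < q) (ha : ‖J 0‖ < 1) :
    (1 - ‖J 0‖ ^ 2) ^ (1 - 1 / q) ∈ dualValues q J := by
  obtain ⟨F, hF, -⟩ := hJ.2.2
  have hm := one_sub_norm_sq_pos ha
  obtain ⟨hmem, hnorm⟩ := memHardy_of_integral_le (hJ.differentiableOn_extremal ha)
    fun r hr => hJ.integral_norm_extremal_rpow_le hq ha hr
  refine ⟨_, _, F, hmem,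
    Real.rpow_le_one (sSup_integralMeans_nonneg q _) hnorm (one_div_nonneg.2 hq.le),
    hJ.isBoundaryFunction_extremal hF ha, hF, ?_⟩
  set c : ℝ := (1 - ‖J 0‖ ^ 2) ^ (-(1 / q))
  set φ := kernelPow (J 0) (2 / q - 1)
  have hvalue : ∫ θ, circleMap 0 1 θ * (c * ((F (circleMap 0 1 θ) - J 0) / circleMap 0 1 θ *
      φ (F (circleMap 0 1 θ))) * conj (F (circleMap 0 1 θ))) ∂circleMeasure =
      (c * (1 - ‖J 0‖ ^ 2) : ℝ) := by
    calc _ = ∫ θ, c * ((F (circleMap 0 1 θ) - J 0) *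
          (conj (F (circleMap 0 1 θ)) * φ (F (circleMap 0 1 θ)))) ∂circleMeasure := by
          congr 1 with θ
          have hne : circleMap 0 1 θ ≠ 0 := circleMap_ne_center one_ne_zero
          field_simp
      _ = (c * (1 - ‖J 0‖ ^ 2) : ℝ) := by
          rw [integral_const_mul,
            hJ.integral_sub_mul_conj_mul_comp hF (analyticOnNhd_kernelPow ha _), kernelPow_zero]
          push_cast
          ring
  rw [inv_two_pi_I_mul_circleIntegral, hvalue, Complex.norm_real,
    Real.norm_of_nonneg (by positivity), ← Real.rpow_add_one hm.ne', neg_add_eq_sub]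

theorem isGreatest_dualValues (hJ : IsInner J) (hq : 1 < q) (ha : ‖J 0‖ < 1) :
    IsGreatest (dualValues q J) ((1 - ‖J 0‖ ^ 2) ^ (1 - 1 / q)) :=
  ⟨hJ.mem_dualValues (one_pos.trans hq) ha, fun _ hx => hJ.le_of_mem_dualValues hq ha hx⟩

end IsInner

end HardyDual

theorem corollary3p5_general (q : ℝ) (hq : 1 < q) (J₁ J₂ : ℂ → ℂ)
    (hJ₁ : HardyDual.IsInner J₁) (hJ₂ : HardyDual.IsInner J₂)
    (hc₁ : ¬ HardyDual.IsConstantOnDisk J₁) (hc₂ : ¬ HardyDual.IsConstantOnDisk J₂)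
    (h₁ : J₁ 0 ≠ 0) :
    BddAbove (HardyDual.dualValues q J₁) ∧
    BddAbove (HardyDual.dualValues q (fun z => J₁ z * J₂ z)) ∧
    sSup (HardyDual.dualValues q J₁) <
      sSup (HardyDual.dualValues q (fun z => J₁ z * J₂ z)) := by
  have ha₁ : ‖J₁ 0‖ < 1 := hJ₁.norm_zero_lt_one hc₁
  have ha₁₂ : ‖J₁ 0 * J₂ 0‖ < ‖J₁ 0‖ := by
    rw [norm_mul]
    exact mul_lt_of_lt_one_right (norm_pos_iff.2 h₁) (hJ₂.norm_zero_lt_one hc₂)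
  have hmax₁ := hJ₁.isGreatest_dualValues hq ha₁
  have hmax₁₂ := (hJ₁.mul hJ₂).isGreatest_dualValues hq (ha₁₂.trans ha₁)
  refine ⟨hmax₁.bddAbove, hmax₁₂.bddAbove, ?_⟩
  rw [hmax₁.csSup_eq, hmax₁₂.csSup_eq]
  have hpos : 0 < 1 - ‖J₁ 0‖ ^ 2 := HardyDual.one_sub_norm_sq_pos ha₁
  have hexp : 0 < 1 - 1 / q := sub_pos.2 ((div_lt_one (one_pos.trans hq)).2 hq)
  gcongr

theorem corollary3p5 (q : ℝ) (hq : 1 < q) (J₁ J₂ : ℂ → ℂ)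
    (hJ₁ : HardyDual.IsInner J₁) (hJ₂ : HardyDual.IsInner J₂)
    (hc₁ : ¬ HardyDual.IsConstantOnDisk J₁) (hc₂ : ¬ HardyDual.IsConstantOnDisk J₂)
    (h₁ : J₁ 0 ≠ 0) (h₂ : J₂ 0 ≠ 0) :
    BddAbove (HardyDual.dualValues q J₁) ∧
    BddAbove (HardyDual.dualValues q (fun z => J₁ z * J₂ z)) ∧
    sSup (HardyDual.dualValues q J₁) <
      sSup (HardyDual.dualValues q (fun z => J₁ z * J₂ z)) :=
  corollary3p5_general q hq J₁ J₂ hJ₁ hJ₂ hc₁ hc₂ h₁
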